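/- Let $\mathbb{F}_q$ be a finite field with $q$ elements, $A=\mathbb{F}_q[\theta]$, $k=\mathbb{F}_q(\theta)$, and let $\mathrm{Spm}\,A$ be the set of monic irreducible polynomials in $A$. Put $\mathcal{A}_k=\prod_{P\in \mathrm{Spm} A}A/(P)\,\big/\bigoplus_{P\in \mathrm{Spm} A}A/(P)$, which is a $k$-algebra via the diagonal map $A\to\mathcal{A}_k$. Let $q'=q^{q-1}$, let $\mathbb{F}_{q'}\supseteq\mathbb{F}_q$ be a field with $q'$ elements, and define $A'$, $k'$, $\mathcal{A}_{k'}$ in the same way with $q'$ in place of $q$. The homomorphism $(a_P)_P\mapsto(b_Q)_Q$, where $b_Q\in A'/(Q)$ is the image of $a_P$ for the prime $P$ of $A$ below $Q$, induces an embedding $\mathcal{A}_k\hookrightarrow\mathcal{A}_{k'}$, by which $\mathcal{A}_k$ is regarded as a subring of $\mathcal{A}_{k'}$. For $n\ge1$ put $[n]=\theta^{q^n}-\theta$, $D_n=[n]^{q^0}[n-1]^{q^1}\cdots[1]^{q^{n-1}}$, $L_n=(-1)^n[n][n-1]\cdots[1]$, and $D_0=L_0=1$. For $n\geq 0$ with $q$-adic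 expansion $n=\sum_j\alpha_jq^j$ ($0\le\alpha_j<q$), put $\Gamma_{n+1}=\prod_jD_j^{\alpha_j}$. The Anderson–Thakur polynomials $H_n(t)\in A[t]$ ($n\ge 0$) are defined by $$\sum_{n\ge0}\frac{H_n(t)}{\Gamma_{n+1}|_{\theta=t}}x^n=\Bigl(1-\sum_{i\ge0}\frac{\prod_{m=1}^{i}(t^{q^i}-\theta^{q^m})}{D_i|_{\theta=t}}x^{q^i}\Bigr)^{-1}.$$ For $n\ge 1$ write $H_{n-1}(t)=\sum_ju_{n,j}t^j$ with $u_{n,j}\in A$. For $\mathbf{s}=(s_1,\dots,s_r)\in\mathbb{N}_{>0}^r$ let $\mathfrak{J}_{\mathbf s}$ be the set of all $\mathbf{j}=(j_1,\dots,j_r)\in\mathbb{N}^r$ with $0\le j_i\le\deg_tH_{s_i-1}$ for all $i$, and put $\theta^{\mathbf j}=\theta^{j_1+\cdots+j_r}$. For $\boldsymbol\epsilon=(\epsilon_1,\dots,\epsilon_r)\in(A^\times)^r$ the alternating finite multiple zeta value $\zeta_{\mathcal{A}_k}(\mathbf s;\boldsymbol\epsilon)\in\mathcal{A}_k$ is the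 class of the family $$\zeta_{\mathcal{A}_k}(\mathbf s;\boldsymbol\epsilon)_P=\sum_{\substack{\deg P>\deg a_1>\cdots>\deg a_r\ge0\\ a_i\in A\text{ monic}}}\frac{\epsilon_1^{\deg a_1}\cdots\epsilon_r^{\deg a_r}}{a_1^{s_1}\cdots a_r^{s_r}}\in A/(P).$$ For $b_1,\dots,b_r\in\mathcal{A}_{k'}$ represented by families $(b_{Q,1})_Q,\dots,(b_{Q,r})_Q$, the finite Carlitz multiple polylogarithm $\mathrm{Li}_{\mathcal{A}_k,\mathbf s}(b_1,\dots,b_r)\in\mathcal{A}_{k'}$, extended from $\mathcal{A}_k$ to $\mathcal{A}_{k'}$, is the class of the family $$\sum_{\deg P>i_1>\cdots>i_r\ge0}\frac{b_{Q,1}^{q^{i_1}}\cdots b_{Q,r}^{q^{i_r}}}{L_{i_1}^{s_1}\cdots L_{i_r}^{s_r}}\in A'/(Q)\qquad(Q\in\mathrm{Spm}\,A'),$$ where $P\in\mathrm{Spm}\,A$ is the prime below $Q$; this does not depend on the representatives. **Theorem.** Let $\mathbf s=(s_1,\dots,s_r)\in\mathbb{N}_{>0}^r$, let $\epsilon_1,\dots,\epsilon_r\in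 A^\times=\mathbb{F}_q^\times$, and let $\gamma_1,\dots,\gamma_r\in A'^\times$ satisfy $\gamma_i^{q-1}=\epsilon_i$ for all $i$. Then $$\zeta_{\mathcal{A}_k}(\mathbf s;\boldsymbol\epsilon)=\frac{1}{\gamma_1\Gamma_{s_1}\cdots\gamma_r\Gamma_{s_r}}\sum_{\mathbf j\in\mathfrak{J}_{\mathbf s}}\theta^{\mathbf j}\,\mathrm{Li}_{\mathcal{A}_k,\mathbf s}(\gamma_1u_{s_1,j_1},\dots,\gamma_ru_{s_r,j_r})$$ in $\mathcal{A}_{k'}$; in particular the right-hand side lies in the subring $\mathcal{A}_k$. -/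

import Mathlib

open Polynomial

noncomputable section

namespace FiniteCarlitz

/-! ### Carlitz's elements of `A = F[θ]`, for a finite field `F` with `q` elements

The variable `θ` of `A = F[θ]` is `Polynomial.X : F[X]`. -/

section Carlitz

variable (F : Type*) [Field F]

/-- The bracket `[n] = θ ^ (q ^ n) - θ`. -/
def bracket (n : ℕ) : F[X] := X ^ (Nat.card F) ^ n - X

/-- `D_n = [n] ^ (q ^ 0) * [n - 1] ^ (q ^ 1) * ⋯ * [1] ^ (q ^ (n - 1))`, with `D_0 = 1`. -/
def carlitzD (n : ℕ) : F[X] :=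
  ∏ i ∈ Finset.range n, bracket F (n - i) ^ (Nat.card F) ^ i

/-- `L_n = (-1) ^ n * [n] * [n - 1] * ⋯ * [1]`, with `L_0 = 1`. -/
def carlitzL (n : ℕ) : F[X] :=
  (-1) ^ n * ∏ i ∈ Finset.Icc 1 n, bracket F i

/-- The Carlitz factorial `Π(n) = ∏ j, D_j ^ α_j`, where `n = ∑ j, α_j * q ^ j` is the `q`-adic
expansion of `n`. -/
def carlitzFactorial (n : ℕ) : F[X] :=
  ((Nat.digits (Nat.card F) n).mapIdx fun j α => carlitzD F j ^ α).prod

/-- The Carlitz gamma `Γ_n = Π(n - 1)`, for `n ≥ 1`. -/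
def carlitzGamma (n : ℕ) : F[X] := carlitzFactorial F (n - 1)

/-- `F(θ, t)`, realized as the fraction field of `F[θ][t] = A[t]`. Here the variable `t` is
`X : F[X][X]`, and `θ` (which takes the place of `y`) is `C X : F[X][X]`. -/
abbrev FieldThetaT := FractionRing F[X][X]

/-- The substitution `a ↦ a|_{θ = t}` from `A = F[θ]` to `A[t]`. -/
def substT : F[X] →+* F[X][X] := mapRingHom C

/-- `G_n(t, θ) = ∏_{i = 1}^n (t ^ (q ^ n) - θ ^ (q ^ i))`. -/
def andersonThakurG (n : ℕ) : F[X][X] :=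
  ∏ i ∈ Finset.Icc 1 n, (X ^ (Nat.card F) ^ n - C X ^ (Nat.card F) ^ i)

/-- The power series `∑_{i ≥ 0} (G_i(t, θ) / D_i|_{θ = t}) x ^ (q ^ i)`. -/
def andersonThakurKernel : PowerSeries (FieldThetaT F) :=
  PowerSeries.mk fun n =>
    ∑ i ∈ (Finset.range (n + 1)).filter (fun i => (Nat.card F) ^ i = n),
      algebraMap F[X][X] (FieldThetaT F) (andersonThakurG F i) /
        algebraMap F[X][X] (FieldThetaT F) (substT F (carlitzD F i))

/-- The element `𝔥_n(t, θ)` of `F(θ, t)` given by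
`∑_n (𝔥_n(t, θ) / Γ_{n+1}|_{θ = t}) x ^ n = (1 - ∑_i (G_i(t, θ) / D_i|_{θ = t}) x ^ (q ^ i))⁻¹`. -/
def andersonThakurFrac (n : ℕ) : FieldThetaT F :=
  algebraMap F[X][X] (FieldThetaT F) (substT F (carlitzGamma F (n + 1))) *
    PowerSeries.coeff n (1 - andersonThakurKernel F)⁻¹

variable {F}

theorem carlitzD_succ (n : ℕ) :
    carlitzD F (n + 1) = carlitzD F n ^ Nat.card F * bracket F (n + 1) := by
  unfold carlitzD
  rw [Finset.prod_range_succ', ← Finset.prod_pow]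
  congr 1
  · refine Finset.prod_congr rfl fun i _ => ?_
    rw [← pow_mul, ← pow_succ, Nat.add_sub_add_right]
  · simp

theorem bracket_ne_zero [Finite F] {n : ℕ} (hn : n ≠ 0) : bracket F n ≠ 0 := by
  have : 1 < Nat.card F ^ n := Nat.one_lt_pow hn Finite.one_lt_card
  intro h
  have h2 := congrArg (fun f => coeff f (Nat.card F ^ n)) h
  simp [bracket, coeff_X, this.ne] at h2

theorem carlitzD_ne_zero [Finite F] (n : ℕ) : carlitzD F n ≠ 0 := by
  refine Finset.prod_ne_zero_iff.2 fun i hi => pow_ne_zero _ (bracket_ne_zero ?_)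
  have := Finset.mem_range.1 hi
  omega

theorem carlitzFactorial_ne_zero [Finite F] (n : ℕ) : carlitzFactorial F n ≠ 0 := by
  rw [carlitzFactorial, Ne, List.prod_eq_zero_iff, List.mem_mapIdx]
  rintro ⟨i, h, h2⟩
  exact pow_ne_zero _ (carlitzD_ne_zero i) h2

/-- Integrality of the Carlitz binomials, in a form with shifted digits. -/
theorem shifted_dvd [Finite F] (j : ℕ) : ∀ (i n : ℕ),
    carlitzD F (i + j) *
        ((Nat.digits (Nat.card F) n).mapIdx fun l α => carlitzD F (i + l) ^ α).prod ∣
      ((Nat.digits (Nat.card F) (n + Nat.card F ^ j)).mapIdx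
        fun l α => carlitzD F (i + l) ^ α).prod := by
  have hq : 1 < Nat.card F := Finite.one_lt_card
  -- the recursion on digits
  have hrec : ∀ i n : ℕ,
      ((Nat.digits (Nat.card F) n).mapIdx fun l α => carlitzD F (i + l) ^ α).prod =
        carlitzD F i ^ (n % Nat.card F) *
          ((Nat.digits (Nat.card F) (n / Nat.card F)).mapIdx
            fun l α => carlitzD F (i + 1 + l) ^ α).prod := by
    intro i n
    rcases Nat.eq_zero_or_pos n with rfl | hn
    · simp
    · rw [Nat.digits_def' hq hn, List.mapIdx_cons, List.prod_cons]
      simp only [add_zero]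
      congr 3
      funext l α
      rw [show i + (l + 1) = i + 1 + l by ring]
  induction j with
  | zero =>
    intro i n
    induction n using Nat.strong_induction_on generalizing i with
    | _ n ih =>
      rw [hrec i n, hrec i (n + Nat.card F ^ 0), pow_zero, add_zero]
      rcases Nat.lt_or_ge (n % Nat.card F + 1) (Nat.card F) with h | h
      · have h1 : (n + 1) % Nat.card F = n % Nat.card F + 1 := by
          rw [Nat.add_mod, Nat.mod_eq_of_lt hq, Nat.mod_eq_of_lt h]
        have h2 : (n + 1) / Nat.card F = n / Nat.card F := by
          rw [Nat.succ_div_of_not_dvd]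
          intro hd
          rw [Nat.dvd_iff_mod_eq_zero, h1] at hd
          omega
        rw [h1, h2, pow_succ]
        exact dvd_of_eq (by ring)
      · have h0 : n % Nat.card F + 1 = Nat.card F := by
          have := Nat.mod_lt n (by omega : 0 < Nat.card F)
          omega
        have h1 : (n + 1) % Nat.card F = 0 := by
          rw [Nat.add_mod, Nat.mod_eq_of_lt hq, h0, Nat.mod_self]
        have h2 : (n + 1) / Nat.card F = n / Nat.card F + 1 :=
          Nat.succ_div_of_dvd (Nat.dvd_of_mod_eq_zero h1)
        have hn : n ≠ 0 := by
          rintro rfl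
          simp at h0
          omega
        have h3 := ih (n / Nat.card F) (Nat.div_lt_self (Nat.pos_of_ne_zero hn) hq) (i + 1)
        rw [pow_zero, add_zero, carlitzD_succ] at h3
        rw [h1, h2, pow_zero, one_mul, ← mul_assoc, ← pow_succ', h0]
        refine dvd_trans (mul_dvd_mul_right (Dvd.intro _ rfl) _) h3
  | succ j ih =>
    intro i n
    have h1 : (n + Nat.card F ^ (j + 1)) % Nat.card F = n % Nat.card F := by
      rw [pow_succ, Nat.add_mul_mod_self_right]
    have h2 : (n + Nat.card F ^ (j + 1)) / Nat.card F = n / Nat.card F + Nat.card F ^ j := by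
      rw [pow_succ, Nat.add_mul_div_right _ _ (by omega)]
    rw [hrec i n, hrec i (n + _), h1, h2, mul_left_comm]
    refine mul_dvd_mul_left _ ?_
    have := ih (i + 1) (n / Nat.card F)
    rwa [show i + 1 + j = i + (j + 1) by ring] at this

theorem carlitzD_mul_carlitzFactorial_dvd [Finite F] (i m : ℕ) :
    carlitzD F i * carlitzFactorial F m ∣ carlitzFactorial F (m + Nat.card F ^ i) := by
  simpa [carlitzFactorial] using shifted_dvd (F := F) i 0 m

theorem substT_injective : Function.Injective (substT F) :=
  map_injective _ C_injective

theorem coeff_zero_andersonThakurKernel [Finite F] :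
    PowerSeries.coeff 0 (andersonThakurKernel F) = 0 := by
  rw [andersonThakurKernel, PowerSeries.coeff_mk]
  refine Finset.sum_eq_zero fun i hi => ?_
  have := (Finset.mem_filter.1 hi).2
  have h2 : 0 < Nat.card F ^ i := pow_pos Finite.card_pos _
  omega

/-- `𝔥_n(t, θ)` is a polynomial: it lies in `A[t]`. -/
theorem andersonThakurFrac_mem [Finite F] (n : ℕ) :
    ∃ H : F[X][X], algebraMap F[X][X] (FieldThetaT F) H = andersonThakurFrac F n := by
  set S : PowerSeries (FieldThetaT F) := (1 - andersonThakurKernel F)⁻¹ with hS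
  have hmul : (1 - andersonThakurKernel F) * S = 1 := by
    refine PowerSeries.mul_inv_cancel _ ?_
    rw [map_sub, ← PowerSeries.coeff_zero_eq_constantCoeff_apply _ |>.symm.symm,
      ← PowerSeries.coeff_zero_eq_constantCoeff_apply, coeff_zero_andersonThakurKernel]
    simp
  have hS1 : S = 1 + andersonThakurKernel F * S := by
    linear_combination hmul
  have hne : ∀ a : F[X], a ≠ 0 → algebraMap F[X][X] (FieldThetaT F) (substT F a) ≠ 0 := by
    intro a ha
    rw [Ne, IsFractionRing.to_map_eq_zero_iff, map_eq_zero_iff _ substT_injective]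
    exact ha
  induction n using Nat.strong_induction_on with
  | _ n ih =>
    have key : andersonThakurFrac F n ∈ (algebraMap F[X][X] (FieldThetaT F)).range := by
      rw [andersonThakurFrac, ← hS, hS1, map_add, mul_add]
      refine add_mem ?_ ?_
      · rw [PowerSeries.coeff_one]
        split_ifs
        · exact ⟨_, (mul_one _).symm⟩
        · rw [mul_zero]; exact zero_mem _
      · rw [PowerSeries.coeff_mul, Finset.mul_sum]
        refine sum_mem fun x hx => ?_
        have hx' := Finset.HasAntidiagonal.mem_antidiagonal.1 hx
        rw [andersonThakurKernel, PowerSeries.coeff_mk, Finset.sum_mul, Finset.mul_sum]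
        refine sum_mem fun i hi => ?_
        have hi' := (Finset.mem_filter.1 hi).2
        have hlt : x.2 < n := by
          have h2 : 0 < Nat.card F ^ i := pow_pos Finite.card_pos _
          omega
        obtain ⟨H, hH⟩ := ih x.2 hlt
        obtain ⟨c, hc⟩ := carlitzD_mul_carlitzFactorial_dvd (F := F) i x.2
        have hn : x.2 + Nat.card F ^ i = n := by omega
        rw [hn] at hc
        refine ⟨andersonThakurG F i * substT F c * H, ?_⟩
        rw [map_mul, map_mul, hH, andersonThakurFrac, ← hS]
        have hD := hne _ (carlitzD_ne_zero (F := F) i)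
        simp only [carlitzGamma, Nat.add_sub_cancel, hc, map_mul]
        field_simp
    exact key

/-- The Anderson–Thakur polynomial `H_n(t) = 𝔥_n(t, θ)`, as an element of `A[t]`. -/
def andersonThakur [Finite F] (n : ℕ) : F[X][X] := (andersonThakurFrac_mem (F := F) n).choose

theorem algebraMap_andersonThakur [Finite F] (n : ℕ) :
    algebraMap F[X][X] (FieldThetaT F) (andersonThakur n) = andersonThakurFrac F n :=
  (andersonThakurFrac_mem n).choose_spec

/-- The coefficients `u_{n, j}` in `A`: `H_{n-1}(t) = ∑_j u_{n, j} t ^ j`, for `n ≥ 1`. -/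
def andersonThakurCoeff [Finite F] (n j : ℕ) : F[X] := (andersonThakur (n - 1)).coeff j

/-- The set `𝔍_s` of all `j = (j_1, …, j_r)` with `0 ≤ j_i ≤ deg_t H_{s_i - 1}`. -/
def indexSet (F : Type*) [Field F] [Finite F] {r : ℕ} (s : Fin r → ℕ) : Finset (Fin r → ℕ) :=
  Fintype.piFinset fun i => Finset.range ((andersonThakur (F := F) (s i - 1)).natDegree + 1)

end Carlitz

/-! ### The ring `𝒜_k` -/

section Ring

/-- `Spm A`: the monic irreducible polynomials in `A = F[θ]`. -/
def Spm (F : Type*) [Field F] : Type _ := {P : F[X] // P.Monic ∧ Irreducible P}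

variable {F : Type*} [Field F]

instance (P : Spm F) : Fact (Irreducible P.1) := ⟨P.2.2⟩

/-- The residue field `A / (P)`. -/
abbrev Residue (P : Spm F) : Type _ := AdjoinRoot P.1

/-- The ideal `⨁_P A/(P)` of `∏_P A/(P)`: the families with finite support. -/
def finSuppIdeal (F : Type*) [Field F] : Ideal ((P : Spm F) → Residue P) where
  carrier := {f | {P | f P ≠ 0}.Finite}
  zero_mem' := by simp
  add_mem' := by
    intro f g hf hg
    refine (Set.Finite.union hf hg).subset fun P hP => ?_
    by_contra h
    simp only [Set.mem_union, Set.mem_ofPred_eq, not_or, not_not] at h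
    exact hP (by simp [h.1, h.2])
  smul_mem' := by
    intro c f hf
    refine Set.Finite.subset hf fun P hP h => hP ?_
    simp [h]

/-- The ring `𝒜_k = ∏_P A/(P) / ⨁_P A/(P)`, where `A = F[θ]` and `k = F(θ)`. -/
def 𝒜 (F : Type*) [Field F] : Type _ := ((P : Spm F) → Residue P) ⧸ finSuppIdeal F

instance : CommRing (𝒜 F) := inferInstanceAs (CommRing (_ ⧸ finSuppIdeal F))

/-- The class in `𝒜_k` of a family of residues. -/
def 𝒜.mk : ((P : Spm F) → Residue P) →+* 𝒜 F := Ideal.Quotient.mk (finSuppIdeal F)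

theorem 𝒜.mk_surjective : Function.Surjective (𝒜.mk (F := F)) :=
  Ideal.Quotient.mk_surjective

theorem 𝒜.mk_eq_mk {f g : (P : Spm F) → Residue P} :
    𝒜.mk f = 𝒜.mk g ↔ {P | f P ≠ g P}.Finite := by
  have h : 𝒜.mk f = 𝒜.mk g ↔ f - g ∈ finSuppIdeal F :=
    Ideal.Quotient.mk_eq_mk_iff_sub_mem f g
  rw [h]
  change Set.Finite {P | (f - g) P ≠ 0} ↔ _
  simp only [Pi.sub_apply, sub_ne_zero]

/-- The diagonal ring homomorphism `A → 𝒜_k`. -/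
def 𝒜.diag : F[X] →+* 𝒜 F := 𝒜.mk.comp (RingHom.pi fun P => AdjoinRoot.mk P.1)

theorem finite_natDegree_lt [Finite F] (n : ℕ) : {f : F[X] | f.natDegree < n}.Finite := by
  have : Finite (degreeLT F n) := Module.finite_of_finite F
  refine (Set.toFinite (degreeLT F n : Set F[X])).subset fun f hf => ?_
  rw [SetLike.mem_coe, mem_degreeLT]
  exact lt_of_le_of_lt degree_le_natDegree (by exact_mod_cast hf)

theorem finite_dvd [Finite F] {a : F[X]} (ha : a ≠ 0) : {P : Spm F | P.1 ∣ a}.Finite := by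
  refine Set.Finite.of_finite_image (f := Subtype.val) ?_ Subtype.val_injective.injOn
  refine (finite_natDegree_lt (F := F) (a.natDegree + 1)).subset ?_
  rintro _ ⟨P, hP, rfl⟩
  exact Nat.lt_succ_of_le (natDegree_le_of_dvd hP ha)

theorem 𝒜.isUnit_diag [Finite F] (a : nonZeroDivisors F[X]) :
    IsUnit (𝒜.diag (a : F[X])) := by
  refine .of_mul_eq_one (𝒜.mk fun P => (AdjoinRoot.mk P.1 (a : F[X]))⁻¹) ?_
  rw [𝒜.diag, RingHom.comp_apply, ← map_mul, ← map_one 𝒜.mk, 𝒜.mk_eq_mk]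
  refine (finite_dvd (nonZeroDivisors.ne_zero a.2)).subset fun P hP => ?_
  rw [Set.mem_ofPred_eq, ← AdjoinRoot.mk_eq_zero]
  by_contra h
  exact hP (mul_inv_cancel₀ h)

/-- The `k`-algebra structure of `𝒜_k`, for `k = F(θ)`: the unique one that extends the diagonal
map `A → 𝒜_k`. -/
instance [Finite F] : Algebra (RatFunc F) (𝒜 F) :=
  (IsLocalization.lift (M := nonZeroDivisors F[X]) (S := RatFunc F)
    (g := 𝒜.diag) 𝒜.isUnit_diag).toAlgebra

theorem 𝒜.algebraMap_algebraMap [Finite F] (a : F[X]) :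
    algebraMap (RatFunc F) (𝒜 F) (algebraMap F[X] (RatFunc F) a) =
      𝒜.mk fun P => AdjoinRoot.mk P.1 a :=
  IsLocalization.lift_eq 𝒜.isUnit_diag a

end Ring

/-! ### Alternating finite multiple zeta values -/

section Zeta

variable {F : Type*} [Field F] [Finite F]

theorem finite_monicTuples (r n : ℕ) :
    {a : Fin r → F[X] | (∀ i, (a i).Monic) ∧ (∀ i, (a i).natDegree < n) ∧
      StrictAnti fun i => (a i).natDegree}.Finite :=
  (Set.Finite.pi' fun _ => finite_natDegree_lt (F := F) n).subset fun _ ha i => ha.2.1 i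

/-- The tuples `(a_1, …, a_r)` of monic polynomials with `n > deg a_1 > ⋯ > deg a_r ≥ 0`. -/
def monicTuples (F : Type*) [Field F] [Finite F] (r n : ℕ) : Finset (Fin r → F[X]) :=
  (finite_monicTuples (F := F) r n).toFinset

/-- The alternating finite multiple zeta value `ζ_{𝒜_k}(s; ε)`, for `s ∈ ℤ ^ r` and
`ε ∈ (A ^ ×) ^ r`. -/
def alternatingFMZV {r : ℕ} (s : Fin r → ℤ) (ε : Fin r → F[X]ˣ) : 𝒜 F :=
  𝒜.mk fun P => ∑ a ∈ monicTuples F r P.1.natDegree,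
    (∏ i, AdjoinRoot.mk P.1 (ε i : F[X]) ^ (a i).natDegree) /
      ∏ i, AdjoinRoot.mk P.1 (a i) ^ s i

end Zeta

/-! ### The extension `k' / k`, and finite Carlitz multiple polylogarithms over `𝒜_{k'}` -/

section Polylog

variable (F : Type*) [Field F] {F' : Type*} [Field F'] [Finite F'] [Algebra F F']

theorem isIntegral_root [Finite F] (Q : Spm F') : IsIntegral F (AdjoinRoot.root Q.1) := by
  have : Module.Finite F F' := Module.Finite.of_finite
  have : Module.Finite F' (AdjoinRoot Q.1) := Q.2.1.finite_adjoinRoot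
  exact isIntegral_trans (R := F) (A := F') _ (Algebra.IsIntegral.isIntegral _)

/-- The prime `P` of `A` below a prime `Q` of `A'`: the monic generator of the kernel of
`A → A' / (Q)`, that is, the minimal polynomial over `F` of the class of `θ`. -/
def below [Finite F] (Q : Spm F') : Spm F :=
  ⟨minpoly F (AdjoinRoot.root Q.1), minpoly.monic (isIntegral_root F Q),
    minpoly.irreducible (isIntegral_root F Q)⟩

theorem below_dvd_iff [Finite F] (Q : Spm F') (a : F[X]) :
    (below F Q).1 ∣ a ↔ Q.1 ∣ a.map (algebraMap F F') := by
  rw [below, ← AdjoinRoot.mk_eq_zero (f := Q.1), minpoly.dvd_iff,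
    ← AdjoinRoot.aeval_eq, aeval_map_algebraMap]

theorem dvd_map_below [Finite F] (Q : Spm F') : Q.1 ∣ (below F Q).1.map (algebraMap F F') :=
  (below_dvd_iff F Q _).1 dvd_rfl

/-- `below F Q` is the only monic irreducible polynomial of `A` that is divisible by `Q`. -/
theorem eq_below_iff [Finite F] (P : Spm F) (Q : Spm F') :
    P = below F Q ↔ Q.1 ∣ P.1.map (algebraMap F F') := by
  refine ⟨fun h => h ▸ dvd_map_below F Q, fun h => ?_⟩
  have h1 := (below_dvd_iff F Q P.1).2 h
  have h2 : Associated (below F Q).1 P.1 := (below F Q).2.2.associated_of_dvd P.2.2 h1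
  exact Subtype.ext (eq_of_monic_of_associated P.2.1 (below F Q).2.1 h2.symm)

/-- The canonical embedding `A/(P) → A'/(Q)` induced by `A → A'`, where `P` is below `Q`. -/
def residueMap [Finite F] (Q : Spm F') : Residue (below F Q) →+* Residue Q :=
  AdjoinRoot.map (algebraMap F F') _ _ (dvd_map_below F Q)

/-- The ring homomorphism `∏_P A/(P) → ∏_Q A'/(Q)` that maps `(a_P)_P` to the family whose
component at `Q` is the image of `a_P`, with `P` the prime below `Q`. -/
def familyMap [Finite F] : ((P : Spm F) → Residue P) →+* ((Q : Spm F') → Residue Q) :=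
  RingHom.pi fun Q => (residueMap F Q).comp (Pi.evalRingHom _ (below F Q))

theorem finite_above [Finite F] (P : Spm F) : {Q : Spm F' | below F Q = P}.Finite := by
  refine (finite_dvd (F := F') (a := P.1.map (algebraMap F F')) ?_).subset ?_
  · exact (P.2.1.map _).ne_zero
  · rintro Q rfl
    exact dvd_map_below F Q

theorem exists_above [Finite F] (P : Spm F) : ∃ Q : Spm F', below F Q = P := by
  have h : ¬ IsUnit (P.1.map (algebraMap F F')) := by
    rw [Polynomial.isUnit_map]
    exact P.2.2.not_isUnit
  obtain ⟨Q, h1, h2, h3⟩ := exists_monic_irreducible_factor _ h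
  exact ⟨⟨Q, h1, h2⟩, ((eq_below_iff F P ⟨Q, h1, h2⟩).2 h3).symm⟩

/-- The embedding `𝒜_k → 𝒜_{k'}`. -/
def embed [Finite F] : 𝒜 F →+* 𝒜 F' :=
  Ideal.Quotient.lift (finSuppIdeal F) (𝒜.mk.comp (familyMap F)) (by
    intro f hf
    have hf' : {P | f P ≠ 0}.Finite := hf
    rw [RingHom.comp_apply, ← map_zero 𝒜.mk, 𝒜.mk_eq_mk]
    refine (hf'.biUnion fun P _ => finite_above F P).subset fun Q hQ => ?_
    refine Set.mem_iUnion₂.2 ⟨below F Q, fun h => hQ ?_, rfl⟩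
    change residueMap F Q (f (below F Q)) = 0
    rw [h, map_zero])

theorem embed_mk [Finite F] (f : (P : Spm F) → Residue P) :
    embed F (F' := F') (𝒜.mk f) = 𝒜.mk fun Q => residueMap F Q (f (below F Q)) := rfl

theorem embed_injective [Finite F] : Function.Injective (embed F (F' := F')) := by
  intro x y
  obtain ⟨f, rfl⟩ := 𝒜.mk_surjective x
  obtain ⟨g, rfl⟩ := 𝒜.mk_surjective y
  rw [embed_mk, embed_mk, 𝒜.mk_eq_mk, 𝒜.mk_eq_mk]
  intro h
  refine (h.image (below F)).subset fun P hP => ?_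
  obtain ⟨Q, rfl⟩ := exists_above F (F' := F') P
  exact ⟨Q, fun h2 => hP ((residueMap F Q).injective h2), rfl⟩

/-- The family of sums
`∑_{deg P > i_1 > ⋯ > i_r ≥ 0} b_{Q,1} ^ (q ^ i_1) ⋯ b_{Q,r} ^ (q ^ i_r) / (L_{i_1} ^ s_1 ⋯ L_{i_r} ^ s_r)`
in `A'/(Q)`, where `P` is the prime of `A` below `Q`. -/
def polylogFamily [Finite F] {r : ℕ} (s : Fin r → ℕ) (b : Fin r → (Q : Spm F') → Residue Q)
    (Q : Spm F') : Residue Q :=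
  open scoped Classical in
  ∑ d ∈ (Fintype.piFinset fun _ : Fin r => Finset.range (below F Q).1.natDegree).filter
      fun d => StrictAnti d,
    (∏ i, b i Q ^ (Nat.card F) ^ d i) /
      ∏ i, AdjoinRoot.mk Q.1 ((carlitzL F (d i)).map (algebraMap F F')) ^ s i

/-- The finite Carlitz multiple polylogarithm, as a function on `𝒜_{k'} ^ r`. It is computed from
representatives of its arguments; see `finitePolylog_mk`. -/
def finitePolylog [Finite F] {r : ℕ} (s : Fin r → ℕ) (b : Fin r → 𝒜 F') : 𝒜 F' :=
  𝒜.mk (polylogFamily F s fun i => (𝒜.mk_surjective (b i)).choose)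

/-- The value does not depend on the chosen representatives. -/
theorem finitePolylog_mk [Finite F] {r : ℕ} (s : Fin r → ℕ)
    (b : Fin r → (Q : Spm F') → Residue Q) :
    finitePolylog F s (fun i => 𝒜.mk (b i)) = 𝒜.mk (polylogFamily F s b) := by
  rw [finitePolylog, 𝒜.mk_eq_mk]
  have h : ∀ i, {Q | (𝒜.mk_surjective (𝒜.mk (b i))).choose Q ≠ b i Q}.Finite := fun i =>
    𝒜.mk_eq_mk.1 (𝒜.mk_surjective (𝒜.mk (b i))).choose_spec
  refine (Set.finite_iUnion h).subset fun Q hQ => ?_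
  by_contra h2
  simp only [Set.mem_iUnion, Set.mem_ofPred_eq, not_exists, not_not] at h2
  exact hQ (by simp only [polylogFamily, h2])

/-- The inclusion of `A = F[θ]` into `k' = F'(θ)`. -/
def toFunctionField (F : Type*) [Field F] (F' : Type*) [Field F'] [Algebra F F'] :
    F[X] →+* RatFunc F' :=
  (algebraMap F'[X] (RatFunc F')).comp (mapRingHom (algebraMap F F'))

end Polylog

end FiniteCarlitz

end

noncomputable section

namespace FiniteCarlitz

/-! ### Powers `q ^ n` in a field that receives `A` -/

section Frobenius

variable {F : Type*} [Field F] [Finite F] {K : Type*} [Field K]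

/-! The theorem rests on the Anderson–Thakur formula for the power sums `S_d(s) = ∑ 1 / a ^ s` over
monic `a` of degree `d`. Raising the coefficients of `H_{s-1}` to the power `q ^ d` and putting `t =
θ` gives `∑_j u_{s,j} ^ (q ^ d) θ ^ j = Γ_s L_d ^ s S_d(s)`.

This formula comes from Carlitz's linear polynomial `e_d(z) = ∑_i D_d / (D_i L_{d-i} ^ (q ^ i)) z ^
(q ^ i)`. It vanishes at every `a` of degree less than `d` and equals `D_d` at monic `a` of degree
`d`, so `∏ (z - a) = e_d(z) - D_d` over these monic `a` (`prod_monics`). The derivative of `e_d` is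
the constant `D_d / L_d`. The logarithmic derivative at `z = L_d x` therefore gives `∑_n L_d ^ (n+1)
S_d(n+1) x ^ n = (1 - e_d(L_d x) / D_d)⁻¹` (`powerSumSeries_mul`). The coefficients of `e_d(L_d x) /
D_d` are those of the Anderson–Thakur kernel after `θ ↦ θ ^ (q ^ d)`, `t ↦ θ`
(`carlitzECoeff_mul_div`), so the two generating series correspond (`twistEval_andersonThakur`).

Cleared of denominators, the formula is an identity in `A` and can be reduced modulo `Q`
(`sum_andersonThakurCoeff`). Since `γ ^ (q ^ d) = ε ^ d γ`, replacing `u` by `γ u` inserts the sign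
`ε ^ d` and a constant `γ`. Multiplying over the `r` slots and summing over decreasing degrees gives
the theorem in each `A'/(Q)` (`sum_indexSet_polylog`). -/

theorem add_pow_card_pow (ι : F[X] →+* K) (n : ℕ) (x y : K) :
    (x + y) ^ Nat.card F ^ n = x ^ Nat.card F ^ n + y ^ Nat.card F ^ n := by
  have : Fintype F := Fintype.ofFinite F
  obtain ⟨p, hp⟩ := CharP.exists F
  obtain ⟨m, hp1, hm⟩ := FiniteField.card F p
  have : Fact p.Prime := ⟨hp1⟩
  -- The constants `F` embed in `K` even when `ι` itself is not injective, as for residue fields.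
  have : CharP K p := charP_of_injective_ringHom (ι.comp C).injective p
  rw [Nat.card_eq_fintype_card, hm, ← pow_mul, add_pow_char_pow]

/-- The `q ^ n`-th power map, as a ring endomorphism of an algebra over `F`. -/
def frob (ι : F[X] →+* K) (n : ℕ) : K →+* K where
  toFun x := x ^ Nat.card F ^ n
  map_one' := one_pow _
  map_mul' x y := mul_pow x y _
  map_zero' := zero_pow (pow_ne_zero _ Nat.card_pos.ne')
  map_add' := add_pow_card_pow ι n

theorem frob_apply (ι : F[X] →+* K) (n : ℕ) (x : K) : frob ι n x = x ^ Nat.card F ^ n := rfl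

theorem sub_pow_card_pow (ι : F[X] →+* K) (n : ℕ) (x y : K) :
    (x - y) ^ Nat.card F ^ n = x ^ Nat.card F ^ n - y ^ Nat.card F ^ n :=
  map_sub (frob ι n) x y

theorem neg_one_pow_card_pow (ι : F[X] →+* K) (n : ℕ) : (-1 : K) ^ Nat.card F ^ n = -1 := by
  have := map_neg (frob ι n) 1
  rwa [map_one] at this

theorem pow_natCard (c : F) : c ^ Nat.card F = c := by
  have : Fintype F := Fintype.ofFinite F
  rw [Nat.card_eq_fintype_card, FiniteField.pow_card]

theorem pow_natCard_pow (n : ℕ) (c : F) : c ^ Nat.card F ^ n = c := by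
  induction n with
  | zero => simp
  | succ n ih => rw [pow_succ, pow_mul, ih, pow_natCard]

theorem map_C_pow (ι : F[X] →+* K) (n : ℕ) (c : F) : ι (C c) ^ Nat.card F ^ n = ι (C c) := by
  rw [← map_pow, ← map_pow, pow_natCard_pow]

end Frobenius

/-! ### Carlitz's linear polynomial `e_d` and its values on `A` -/

section CarlitzE

variable {F : Type*} [Field F]

theorem carlitzL_succ (n : ℕ) : carlitzL F (n + 1) = -(bracket F (n + 1) * carlitzL F n) := by
  rw [carlitzL, carlitzL, Finset.prod_Icc_succ_top (by omega)]
  ring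

variable {K : Type*} [Field K] (ι : F[X] →+* K)

/-- The coefficient of `z ^ (q ^ i)` in `∏_{deg a < d} (z - a)`. -/
def carlitzECoeff (d i : ℕ) : K :=
  -- Beyond `d` the truncated `d - i` would give a spurious coefficient; with zero there, sums over
  -- `i` may run over any longer range.
  if i ≤ d then
    ι (carlitzD F d) / (ι (carlitzD F i) * ι (carlitzL F (d - i)) ^ Nat.card F ^ i)
  else 0

/-- Carlitz's `F`-linear polynomial `∏_{deg a < d} (z - a)`. -/
def carlitzE (d : ℕ) : K[X] :=
  ∑ i ∈ Finset.range (d + 1), C (carlitzECoeff ι d i) * X ^ Nat.card F ^ i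

variable {ι}

theorem carlitzECoeff_of_lt {d i : ℕ} (h : d < i) : carlitzECoeff ι d i = 0 :=
  if_neg (by omega)

theorem eval_carlitzE {d N : ℕ} (h : d < N) (z : K) :
    (carlitzE ι d).eval z = ∑ i ∈ Finset.range N, carlitzECoeff ι d i * z ^ Nat.card F ^ i := by
  simp only [carlitzE, eval_finsetSum, eval_mul, eval_C, eval_pow, eval_X]
  refine Finset.sum_subset (Finset.range_mono h) fun i _ hi => ?_
  rw [carlitzECoeff_of_lt (by simpa using hi), zero_mul]

variable [Finite F]

theorem carlitzL_ne_zero (n : ℕ) : carlitzL F n ≠ 0 := by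
  refine mul_ne_zero (pow_ne_zero _ (by simp)) (Finset.prod_ne_zero_iff.2 fun i hi => ?_)
  exact bracket_ne_zero (by have := Finset.mem_Icc.1 hi; omega)

theorem eval_carlitzE_add (d : ℕ) (x y : K) :
    (carlitzE ι d).eval (x + y) = (carlitzE ι d).eval x + (carlitzE ι d).eval y := by
  simp only [eval_carlitzE d.lt_succ_self, add_pow_card_pow ι, mul_add, Finset.sum_add_distrib]

theorem eval_carlitzE_C_mul (d : ℕ) (c : F) (x : K) :
    (carlitzE ι d).eval (ι (C c) * x) = ι (C c) * (carlitzE ι d).eval x := by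
  simp only [eval_carlitzE d.lt_succ_self, mul_pow, map_C_pow, Finset.mul_sum]
  exact Finset.sum_congr rfl fun i _ => by ring

theorem carlitzECoeff_self (hι : Function.Injective ι) (d : ℕ) : carlitzECoeff ι d d = 1 := by
  have h : ι (carlitzD F d) ≠ 0 := (map_ne_zero_iff ι hι).2 (carlitzD_ne_zero d)
  simp [carlitzECoeff, carlitzL, h]

theorem carlitzECoeff_zero_succ (hι : Function.Injective ι) (d : ℕ) :
    carlitzECoeff ι (d + 1) 0 = -(ι (carlitzD F d) ^ (Nat.card F - 1) * carlitzECoeff ι d 0) := by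
  have hq : 0 < Nat.card F := Nat.card_pos
  have h1 : ι (bracket F (d + 1)) ≠ 0 := (map_ne_zero_iff ι hι).2 (bracket_ne_zero (by omega))
  have h2 : ι (carlitzL F d) ≠ 0 := (map_ne_zero_iff ι hι).2 (carlitzL_ne_zero _)
  have h3 : ι (carlitzD F d) ^ Nat.card F = ι (carlitzD F d) ^ (Nat.card F - 1) *
      ι (carlitzD F d) := by rw [← pow_succ, Nat.sub_add_cancel hq]
  have h4 : carlitzD F 0 = 1 := by simp [carlitzD]
  simp only [carlitzECoeff, zero_le, if_true, carlitzD_succ, carlitzL_succ, h4, map_mul, map_pow,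
    map_neg, map_one, Nat.sub_zero, pow_zero, pow_one, h3]
  field_simp

/-- This is the coefficient form of `e_{d+1} = e_d ^ q - D_d ^ (q-1) e_d`. For `i < d` it reduces to
`[d+1] = [i+1] + [d-i] ^ (q ^ (i+1))`. -/
theorem carlitzECoeff_succ_succ (hι : Function.Injective ι) (d i : ℕ) :
    carlitzECoeff ι (d + 1) (i + 1) = carlitzECoeff ι d i ^ Nat.card F -
      ι (carlitzD F d) ^ (Nat.card F - 1) * carlitzECoeff ι d (i + 1) := by
  have hq : 0 < Nat.card F := Nat.card_pos
  have h3 : ι (carlitzD F d) ^ Nat.card F = ι (carlitzD F d) ^ (Nat.card F - 1) *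
      ι (carlitzD F d) := by rw [← pow_succ, Nat.sub_add_cancel hq]
  rcases lt_trichotomy d i with h | rfl | h
  · rw [carlitzECoeff_of_lt, carlitzECoeff_of_lt h, carlitzECoeff_of_lt, zero_pow hq.ne'] <;>
      simp <;> omega
  · rw [carlitzECoeff_self hι, carlitzECoeff_self hι, carlitzECoeff_of_lt (by omega)]
    simp
  · obtain ⟨e, rfl⟩ : ∃ e, d = i + 1 + e := ⟨d - (i + 1), by omega⟩
    have hb (n : ℕ) (hn : n ≠ 0) : ι (bracket F n) ≠ 0 :=
      (map_ne_zero_iff ι hι).2 (bracket_ne_zero hn)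
    have hL (n : ℕ) : ι (carlitzL F n) ≠ 0 := (map_ne_zero_iff ι hι).2 (carlitzL_ne_zero n)
    have hD (n : ℕ) : ι (carlitzD F n) ≠ 0 := (map_ne_zero_iff ι hι).2 (carlitzD_ne_zero n)
    have key : ι (bracket F (i + 1 + e + 1)) = ι (bracket F (i + 1)) +
        ι (bracket F (e + 1)) ^ Nat.card F ^ (i + 1) := by
      simp only [bracket, map_sub, map_pow, sub_pow_card_pow ι, ← pow_mul, ← pow_add]
      rw [show e + 1 + (i + 1) = i + 1 + e + 1 by ring]
      ring
    have e1 : i + 1 + e + 1 - (i + 1) = e + 1 := by omega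
    have e2 : i + 1 + e - i = e + 1 := by omega
    have e3 : i + 1 + e - (i + 1) = e := by omega
    have e4 : ι (carlitzL F (e + 1)) ^ Nat.card F ^ (i + 1) =
        -(ι (bracket F (e + 1)) ^ Nat.card F ^ (i + 1) *
          ι (carlitzL F e) ^ Nat.card F ^ (i + 1)) := by
      rw [carlitzL_succ, map_neg, neg_eq_neg_one_mul, mul_pow, neg_one_pow_card_pow ι, map_mul,
        mul_pow]
      ring
    have e5 : (ι (carlitzL F (e + 1)) ^ Nat.card F ^ i) ^ Nat.card F =
        ι (carlitzL F (e + 1)) ^ Nat.card F ^ (i + 1) := by rw [← pow_mul, ← pow_succ]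
    rw [carlitzECoeff, carlitzECoeff, carlitzECoeff, if_pos (by omega), if_pos (by omega),
      if_pos (by omega), e1, e2, e3, carlitzD_succ, carlitzD_succ, div_pow, mul_pow, e5, e4,
      map_mul, map_mul, key, map_pow, map_pow, h3]
    have := hb (i + 1) (by omega)
    have := pow_ne_zero (Nat.card F ^ (i + 1)) (hb (e + 1) (by omega))
    have := pow_ne_zero (Nat.card F ^ (i + 1)) (hL e)
    have := pow_ne_zero (Nat.card F) (hD i)
    have := hD (i + 1 + e)
    field_simp
    ring

/-- The coefficient form of `e_{d+1}(θ z) - θ e_{d+1}(z) = [d+1] e_d(z) ^ q`, which serves to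
evaluate `e_{d+1}` at `θ ^ (d+1)`. -/
theorem bracket_mul_carlitzECoeff (hι : Function.Injective ι) (d i : ℕ) :
    (ι X ^ Nat.card F ^ (i + 1) - ι X) * carlitzECoeff ι (d + 1) (i + 1) =
      ι (bracket F (d + 1)) * carlitzECoeff ι d i ^ Nat.card F := by
  have hq : 0 < Nat.card F := Nat.card_pos
  rcases lt_or_ge d i with h | h
  · rw [carlitzECoeff_of_lt (by omega), carlitzECoeff_of_lt h, zero_pow hq.ne']
    simp
  have hb : ι (bracket F (i + 1)) ≠ 0 := (map_ne_zero_iff ι hι).2 (bracket_ne_zero (by omega))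
  have h1 : ι X ^ Nat.card F ^ (i + 1) - ι X = ι (bracket F (i + 1)) := by simp [bracket]
  rw [h1, carlitzECoeff, carlitzECoeff, if_pos (by omega), if_pos h, carlitzD_succ, carlitzD_succ,
    div_pow, mul_pow, ← pow_mul, ← pow_succ, Nat.add_sub_add_right]
  simp only [map_mul, map_pow]
  have hL := pow_ne_zero (Nat.card F ^ (i + 1))
    ((map_ne_zero_iff ι hι).2 (carlitzL_ne_zero (F := F) (d - i)))
  have hD := pow_ne_zero (Nat.card F) ((map_ne_zero_iff ι hι).2 (carlitzD_ne_zero (F := F) i))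
  field_simp

theorem eval_carlitzE_succ (hι : Function.Injective ι) (d : ℕ) (z : K) :
    (carlitzE ι (d + 1)).eval z = (carlitzE ι d).eval z ^ Nat.card F -
      ι (carlitzD F d) ^ (Nat.card F - 1) * (carlitzE ι d).eval z := by
  have hf : (carlitzE ι d).eval z ^ Nat.card F = ∑ i ∈ Finset.range (d + 1),
      carlitzECoeff ι d i ^ Nat.card F * z ^ Nat.card F ^ (i + 1) := by
    have := map_sum (frob ι 1) (fun i => carlitzECoeff ι d i * z ^ Nat.card F ^ i)
      (Finset.range (d + 1))
    simp only [frob_apply, pow_one] at this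
    rw [eval_carlitzE d.lt_succ_self, this]
    exact Finset.sum_congr rfl fun i _ => by rw [mul_pow, ← pow_mul, ← pow_succ]
  rw [hf, eval_carlitzE (N := d + 2) (by omega), eval_carlitzE (N := d + 2) (d := d) (by omega),
    Finset.sum_range_succ' _ (d + 1), Finset.sum_range_succ' _ (d + 1),
    carlitzECoeff_zero_succ hι, mul_add, Finset.mul_sum]
  simp only [carlitzECoeff_succ_succ hι, sub_mul, Finset.sum_sub_distrib, mul_assoc]
  ring

theorem eval_carlitzE_X_mul (hι : Function.Injective ι) (d : ℕ) (z : K) :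
    (carlitzE ι (d + 1)).eval (ι X * z) = ι X * (carlitzE ι (d + 1)).eval z +
      ι (bracket F (d + 1)) * (carlitzE ι d).eval z ^ Nat.card F := by
  have hf : (carlitzE ι d).eval z ^ Nat.card F = ∑ i ∈ Finset.range (d + 1),
      carlitzECoeff ι d i ^ Nat.card F * z ^ Nat.card F ^ (i + 1) := by
    have := map_sum (frob ι 1) (fun i => carlitzECoeff ι d i * z ^ Nat.card F ^ i)
      (Finset.range (d + 1))
    simp only [frob_apply, pow_one] at this
    rw [eval_carlitzE d.lt_succ_self, this]
    exact Finset.sum_congr rfl fun i _ => by rw [mul_pow, ← pow_mul, ← pow_succ]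
  rw [hf, eval_carlitzE (N := d + 2) (by omega), eval_carlitzE (N := d + 2) (by omega),
    Finset.sum_range_succ', Finset.sum_range_succ' _ (d + 1), mul_add, Finset.mul_sum,
    Finset.mul_sum]
  simp only [← mul_assoc, ← bracket_mul_carlitzECoeff hι]
  simp only [sub_mul, Finset.sum_sub_distrib, mul_pow, pow_zero, pow_one]
  rw [add_right_comm, add_comm (Finset.sum _ _) (_ - _)]
  rw [show ∀ a b c : K, a - b + b + c = a + c by intros; ring]
  congr 1
  · exact Finset.sum_congr rfl fun i _ => by ring
  · ring

/-- The two claims need a joint induction. If `a` has degree at most `d` and coefficient `c` there,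
linearity gives `e_d(a) = c D_d`, which `z ^ q - D_d ^ (q-1) z` kills because `c ^ q = c`. Then
`e_{d+1}(θ ^ d) = 0`, so multiplication by `θ` leaves `[d+1] D_d ^ q = D_{d+1}`. -/
theorem eval_carlitzE_X_pow_and (hι : Function.Injective ι) (d : ℕ) :
    (carlitzE ι d).eval (ι (X ^ d)) = ι (carlitzD F d) ∧
      ∀ a : F[X], a.degree < d → (carlitzE ι d).eval (ι a) = 0 := by
  have hq : 0 < Nat.card F := Nat.card_pos
  induction d with
  | zero =>
    refine ⟨?_, fun a ha => ?_⟩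
    · simp [carlitzE, carlitzECoeff_self hι, carlitzD]
    · have : a = 0 := by simpa [degree_lt_iff_coeff_zero] using ha
      simp [carlitzE, carlitzECoeff_self hι, this]
  | succ d ih =>
    have hz : ∀ a : F[X], a.degree < (d + 1 : ℕ) → (carlitzE ι (d + 1)).eval (ι a) = 0 := by
      intro a ha
      have h1 : (a - C (a.coeff d) * X ^ d).degree < (d : WithBot ℕ) := by
        rw [degree_lt_iff_coeff_zero] at ha ⊢
        intro m hm
        rcases hm.eq_or_lt with rfl | hm
        · simp
        · simp [coeff_X_pow, hm.ne', ha m hm]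
      have h2 : (carlitzE ι d).eval (ι a) = ι (C (a.coeff d)) * ι (carlitzD F d) := by
        rw [← sub_add_cancel a (C (a.coeff d) * X ^ d), map_add, eval_carlitzE_add, ih.2 _ h1,
          zero_add, map_mul, eval_carlitzE_C_mul, ih.1]
        simp
      rw [eval_carlitzE_succ hι, h2, mul_pow]
      have h3 := map_C_pow ι 1 (a.coeff d)
      rw [pow_one] at h3
      have h4 : ι (carlitzD F d) ^ Nat.card F = ι (carlitzD F d) ^ (Nat.card F - 1) *
          ι (carlitzD F d) := by rw [← pow_succ, Nat.sub_add_cancel hq]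
      rw [h3, h4]
      ring
    refine ⟨?_, hz⟩
    rw [pow_succ', map_mul, eval_carlitzE_X_mul hι, ih.1, hz _ (degree_X_pow_le _ |>.trans_lt
      (by exact_mod_cast d.lt_succ_self)), carlitzD_succ, map_mul, map_pow]
    ring

theorem eval_carlitzE_monic (hι : Function.Injective ι) {d : ℕ} {a : F[X]} (ha : a.Monic) (hd : a.natDegree = d) :
    (carlitzE ι d).eval (ι a) = ι (carlitzD F d) := by
  have h1 : (a - X ^ d).degree < (d : WithBot ℕ) := by
    rw [degree_lt_iff_coeff_zero]
    intro m hm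
    rcases hm.eq_or_lt with rfl | hm
    · have : a.coeff a.natDegree = 1 := ha
      simp [← hd, this]
    · simp [coeff_X_pow, hm.ne', coeff_eq_zero_of_natDegree_lt (hd.trans_lt hm)]
  rw [← sub_add_cancel a (X ^ d), map_add, eval_carlitzE_add, (eval_carlitzE_X_pow_and hι d).2 _ h1,
    (eval_carlitzE_X_pow_and hι d).1, zero_add]

end CarlitzE

/-! ### Monic polynomials of degree `d` and the generating series of their power sums -/

section Monics

variable {F : Type*} [Field F] [Finite F]

theorem finite_monics (F : Type*) [Field F] [Finite F] (d : ℕ) :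
    {a : F[X] | a.Monic ∧ a.natDegree = d}.Finite :=
  (finite_natDegree_lt (d + 1)).subset fun _ ha => ha.2.trans_lt d.lt_succ_self

/-- The monic polynomials of degree `d`. -/
def monics (F : Type*) [Field F] [Finite F] (d : ℕ) : Finset F[X] :=
  (finite_monics F d).toFinset

theorem mem_monics {d : ℕ} {a : F[X]} : a ∈ monics F d ↔ a.Monic ∧ a.natDegree = d := by
  simp [monics]

theorem card_monics (d : ℕ) : (monics F d).card = Nat.card F ^ d := by
  have e := (monicEquivDegreeLT (R := F) d).trans (degreeLTEquiv F d).toEquiv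
  have h := Nat.card_congr e
  rw [Nat.card_fun, Nat.card_fin] at h
  rw [← h, monics, ← Set.ncard_eq_toFinset_card _ (finite_monics F d)]
  rfl

variable {K : Type*} [Field K] {ι : F[X] →+* K}

theorem degree_carlitzE_monic (hι : Function.Injective ι) (d : ℕ) :
    (carlitzE ι d).Monic ∧ (carlitzE ι d).natDegree = Nat.card F ^ d := by
  have h : (∑ i ∈ Finset.range d, C (carlitzECoeff ι d i) * X ^ Nat.card F ^ i).degree <
      ((Nat.card F ^ d : ℕ) : WithBot ℕ) := by
    refine (degree_sum_le _ _).trans_lt ((Finset.sup_lt_iff (WithBot.bot_lt_coe _)).2 fun i hi => ?_)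
    refine (degree_C_mul_X_pow_le _ _).trans_lt ?_
    exact_mod_cast Nat.pow_lt_pow_right Finite.one_lt_card (Finset.mem_range.1 hi)
  rw [carlitzE, Finset.sum_range_succ, carlitzECoeff_self hι, C_1, one_mul, add_comm]
  refine ⟨monic_X_pow_add h, ?_⟩
  rw [natDegree_eq_of_degree_eq_some]
  rw [degree_add_eq_left_of_degree_lt (by rwa [degree_X_pow]), degree_X_pow]

/-- Both sides are monic of degree `q ^ d`, and the `q ^ d` distinct elements `ι a` are roots of the
right side. -/
theorem prod_monics (hι : Function.Injective ι) (d : ℕ) :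
    ∏ a ∈ monics F d, (X - C (ι a)) = carlitzE ι d - C (ι (carlitzD F d)) := by
  classical
  obtain ⟨hm, hd⟩ := degree_carlitzE_monic hι d
  have hpos : 0 < (carlitzE ι d).degree := by
    rw [← natDegree_pos_iff_degree_pos, hd]
    exact pow_pos Nat.card_pos _
  have hlt : (C (ι (carlitzD F d))).degree < (carlitzE ι d).degree :=
    degree_C_le.trans_lt hpos
  have hm' : (carlitzE ι d - C (ι (carlitzD F d))).Monic := hm.sub_of_left hlt
  have hd' : (carlitzE ι d - C (ι (carlitzD F d))).natDegree = Nat.card F ^ d := by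
    rw [natDegree_sub_C, hd]
  have hle : ((monics F d).image ι).val ≤ (carlitzE ι d - C (ι (carlitzD F d))).roots := by
    rw [Finset.val_le_iff_val_subset]
    intro x hx
    obtain ⟨a, ha, rfl⟩ := Finset.mem_image.1 hx
    rw [mem_roots hm'.ne_zero, IsRoot, eval_sub, eval_C,
      eval_carlitzE_monic hι (mem_monics.1 ha).1 (mem_monics.1 ha).2, sub_self]
  have heq : ((monics F d).image ι).val = (carlitzE ι d - C (ι (carlitzD F d))).roots := by
    refine Multiset.eq_of_le_of_card_le hle ((card_roots' _).trans ?_)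
    rw [hd', Finset.card_val, Finset.card_image_of_injective _ hι, card_monics]
  have hroots : Multiset.card (carlitzE ι d - C (ι (carlitzD F d))).roots =
      (carlitzE ι d - C (ι (carlitzD F d))).natDegree := by
    rw [hd', ← heq, Finset.card_val, Finset.card_image_of_injective _ hι, card_monics]
  rw [← prod_multiset_X_sub_C_of_monic_of_roots_card_eq hm' hroots, ← heq,
    Finset.image_val_of_injOn hι.injOn, Multiset.map_map]
  rfl

theorem natCast_card_eq_zero (ι : F[X] →+* K) : ((Nat.card F : ℕ) : K) = 0 := by
  have : Fintype F := Fintype.ofFinite F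
  have h : ((Nat.card F : ℕ) : F) = 0 := by
    rw [Nat.card_eq_fintype_card, FiniteField.cast_card_eq_zero]
  simpa only [map_natCast, map_zero] using congrArg (ι.comp C) h

/-- Only the linear term survives, since `q = 0` in `K`. -/
theorem derivative_carlitzE (d : ℕ) :
    derivative (carlitzE ι d) = C (ι (carlitzD F d) / ι (carlitzL F d)) := by
  have h0 : carlitzD F 0 = 1 := by simp [carlitzD]
  rw [carlitzE, derivative_sum, Finset.sum_range_succ', Finset.sum_eq_zero]
  · simp [carlitzECoeff, h0]
  · intro i _
    rw [derivative_C_mul_X_pow]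
    simp [natCast_card_eq_zero ι]

theorem sum_prod_erase_monics (hι : Function.Injective ι) (d : ℕ) [DecidableEq F[X]] :
    ∑ a ∈ monics F d, ∏ b ∈ (monics F d).erase a, (X - C (ι b)) =
      C (ι (carlitzD F d) / ι (carlitzL F d)) := by
  have h := congrArg derivative (prod_monics hι d)
  rw [derivative_sub, derivative_C, sub_zero, derivative_carlitzE, derivative_prod_finset] at h
  simpa using h

/-- The power sum `∑ 1 / a ^ s` over the monic polynomials of degree `d`. -/
def powerSum (ι : F[X] →+* K) (d s : ℕ) : K := ∑ a ∈ monics F d, (ι a ^ s)⁻¹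

/-- The generating series `∑_n L_d ^ (n + 1) (∑_a 1 / a ^ (n + 1)) x ^ n`. -/
def powerSumSeries (ι : F[X] →+* K) (d : ℕ) : PowerSeries K :=
  PowerSeries.mk fun n => ι (carlitzL F d) ^ (n + 1) * powerSum ι d (n + 1)

theorem powerSumSeries_mul (hι : Function.Injective ι) (d : ℕ) :
    powerSumSeries ι d * (1 - ∑ i ∈ Finset.range (d + 1),
      PowerSeries.C (carlitzECoeff ι d i * ι (carlitzL F d) ^ Nat.card F ^ i / ι (carlitzD F d)) *
        PowerSeries.X ^ Nat.card F ^ i) = 1 := by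
  classical
  set L := ι (carlitzL F d) with hLdef
  set D := ι (carlitzD F d) with hDdef
  have hL : L ≠ 0 := (map_ne_zero_iff ι hι).2 (carlitzL_ne_zero d)
  have hD : D ≠ 0 := (map_ne_zero_iff ι hι).2 (carlitzD_ne_zero d)
  set y : PowerSeries K := PowerSeries.C L * PowerSeries.X with hy
  -- The geometric expansion of `1 / (a - L x)`.
  let g : F[X] → PowerSeries K := fun a => PowerSeries.mk fun n => L ^ n * (ι a)⁻¹ ^ (n + 1)
  have hg : ∀ a ∈ monics F d, (y - PowerSeries.C (ι a)) * g a = -1 := by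
    intro a ha
    have ha0 : ι a ≠ 0 := (map_ne_zero_iff ι hι).2 (mem_monics.1 ha).1.ne_zero
    ext n
    rw [sub_mul, map_sub, hy, mul_assoc, PowerSeries.coeff_C_mul, PowerSeries.coeff_C_mul]
    cases n with
    | zero => simp [g, ha0]
    | succ n =>
      rw [PowerSeries.coeff_succ_X_mul]
      simp only [g, PowerSeries.coeff_mk, map_neg, PowerSeries.coeff_one]
      rw [if_neg (by omega), pow_succ (ι a)⁻¹ (n + 1)]
      field_simp
      ring
  have hZ : powerSumSeries ι d = PowerSeries.C L * ∑ a ∈ monics F d, g a := by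
    ext n
    rw [powerSumSeries, PowerSeries.coeff_mk, PowerSeries.coeff_C_mul, map_sum, powerSum, pow_succ',
      mul_assoc, Finset.mul_sum (a := L ^ n)]
    simp [g, hLdef]
  have hE : aeval y (carlitzE ι d) = ∑ i ∈ Finset.range (d + 1),
      PowerSeries.C (carlitzECoeff ι d i * L ^ Nat.card F ^ i) *
        PowerSeries.X ^ Nat.card F ^ i := by
    rw [carlitzE, map_sum]
    refine Finset.sum_congr rfl fun i _ => ?_
    rw [map_mul, map_pow, aeval_X, aeval_C, hy, mul_pow, map_mul, map_pow, mul_assoc]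
    rfl
  have hprod := congrArg (aeval y) (prod_monics hι d)
  have hsum := congrArg (aeval y) (sum_prod_erase_monics hι d)
  simp only [map_prod, map_sub, map_sum, aeval_X, aeval_C] at hprod hsum
  change ∏ a ∈ monics F d, (y - PowerSeries.C (ι a)) = _ - PowerSeries.C D at hprod
  change ∑ a ∈ monics F d, ∏ b ∈ (monics F d).erase a, (y - PowerSeries.C (ι b)) =
    PowerSeries.C (D / L) at hsum
  -- The logarithmic derivative of `∏ (z - a)` at `z = L x`, with the denominator multiplied out.
  have hmain : (∑ a ∈ monics F d, g a) * (PowerSeries.C D - aeval y (carlitzE ι d)) =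
      PowerSeries.C (D / L) := by
    rw [← hsum, ← neg_sub, ← hprod, mul_neg, Finset.sum_mul, ← Finset.sum_neg_distrib]
    refine Finset.sum_congr rfl fun a ha => ?_
    rw [← Finset.mul_prod_erase _ _ ha, ← mul_assoc, mul_comm (g a), hg a ha]
    ring
  have hfac : 1 - ∑ i ∈ Finset.range (d + 1),
      PowerSeries.C (carlitzECoeff ι d i * L ^ Nat.card F ^ i / D) *
        PowerSeries.X ^ Nat.card F ^ i =
      PowerSeries.C D⁻¹ * (PowerSeries.C D - aeval y (carlitzE ι d)) := by
    rw [hE, mul_sub, ← map_mul, inv_mul_cancel₀ hD, map_one, Finset.mul_sum]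
    congr 1
    refine Finset.sum_congr rfl fun i _ => ?_
    rw [← mul_assoc, ← map_mul]
    congr 2
    field_simp
  rw [hfac, hZ, mul_mul_mul_comm, hmain, ← map_mul, ← map_mul]
  rw [show L * D⁻¹ * (D / L) = 1 by field_simp, map_one]

end Monics

/-! ### The substitution `θ ↦ θ ^ (q ^ d)`, `t ↦ θ` -/

section Specialization

variable {F : Type*} [Field F]

theorem carlitzL_add (e i : ℕ) :
    carlitzL F (e + i) = carlitzL F e * ∏ m ∈ Finset.Icc 1 i, -bracket F (e + m) := by
  induction i with
  | zero => simp
  | succ i ih =>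
    rw [← add_assoc, carlitzL_succ, ih, Finset.prod_Icc_succ_top (by omega), add_assoc]
    ring

variable [Finite F] {K : Type*} [Field K]

/-- The homomorphism `A[t] → K` with `t ↦ θ` that raises the coefficients in `A` to the power
`q ^ d`. -/
def twistEval (ι : F[X] →+* K) (d : ℕ) : F[X][X] →+* K :=
  eval₂RingHom ((frob ι d).comp ι) (ι X)

theorem twistEval_apply (ι : F[X] →+* K) (d : ℕ) (H : F[X][X]) :
    twistEval ι d H =
      ∑ j ∈ Finset.range (H.natDegree + 1), ι (H.coeff j) ^ Nat.card F ^ d * ι X ^ j := by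
  rw [twistEval, coe_eval₂RingHom, eval₂_eq_sum_range]
  rfl

theorem twistEval_substT (ι : F[X] →+* K) (d : ℕ) (a : F[X]) :
    twistEval ι d (substT F a) = ι a := by
  have : (twistEval ι d).comp (substT F) = ι := by
    ext c
    · simp [twistEval, substT, frob_apply, map_C_pow]
    · simp [twistEval, substT]
  exact RingHom.congr_fun this a

theorem twistEval_andersonThakurG (ι : F[X] →+* K) (d i : ℕ) :
    twistEval ι d (andersonThakurG F i) =
      ∏ m ∈ Finset.Icc 1 i, (ι X ^ Nat.card F ^ i - ι X ^ Nat.card F ^ (d + m)) := by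
  simp only [andersonThakurG, twistEval, map_prod, map_sub, map_pow, coe_eval₂RingHom, eval₂_X,
    eval₂_C, RingHom.comp_apply, frob_apply, ← pow_mul, ← pow_add]

theorem twistEval_andersonThakurG_of_lt (ι : F[X] →+* K) {d i : ℕ} (h : d < i) :
    twistEval ι d (andersonThakurG F i) = 0 := by
  rw [twistEval_andersonThakurG]
  -- The factor `m = i - d` is `θ ^ (q ^ i) - θ ^ (q ^ i)`.
  refine Finset.prod_eq_zero (i := i - d) (Finset.mem_Icc.2 (by omega)) ?_
  rw [Nat.add_sub_cancel' h.le, sub_self]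

theorem twistEval_andersonThakurG_mul (ι : F[X] →+* K) {d i : ℕ} (h : i ≤ d) :
    twistEval ι d (andersonThakurG F i) * ι (carlitzL F (d - i)) ^ Nat.card F ^ i =
      ι (carlitzL F d) ^ Nat.card F ^ i := by
  obtain ⟨e, rfl⟩ := Nat.exists_eq_add_of_le' h
  rw [Nat.add_sub_cancel, carlitzL_add, map_mul, mul_pow, mul_comm, twistEval_andersonThakurG,
    map_prod, ← Finset.prod_pow]
  congr 1
  refine Finset.prod_congr rfl fun m _ => ?_
  rw [bracket, neg_sub, map_sub, sub_pow_card_pow ι, map_pow, ← pow_mul, ← pow_add]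
  rw [show e + m + i = e + i + m by ring]

theorem carlitzECoeff_mul_div {ι : F[X] →+* K} (hι : Function.Injective ι) (d i : ℕ) :
    carlitzECoeff ι d i * ι (carlitzL F d) ^ Nat.card F ^ i / ι (carlitzD F d) =
      twistEval ι d (andersonThakurG F i) / ι (carlitzD F i) := by
  rcases lt_or_ge d i with h | h
  · rw [carlitzECoeff_of_lt h, twistEval_andersonThakurG_of_lt ι h]
    simp
  · have hL := pow_ne_zero (Nat.card F ^ i)
      ((map_ne_zero_iff ι hι).2 (carlitzL_ne_zero (F := F) (d - i)))
    have hD (n : ℕ) : ι (carlitzD F n) ≠ 0 := (map_ne_zero_iff ι hι).2 (carlitzD_ne_zero n)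
    have := hD i
    have := hD d
    rw [carlitzECoeff, if_pos h, ← twistEval_andersonThakurG_mul ι h]
    field_simp

end Specialization

/-! ### Comparison of the two generating series by recursion -/

section Recursion

variable {K : Type*} [Field K]

theorem coeff_of_mul_one_sub_eq_one {N : ℕ} {e : ℕ → ℕ} {b : ℕ → K} {V : PowerSeries K}
    (h : V * (1 - ∑ i ∈ Finset.range N, PowerSeries.C (b i) * PowerSeries.X ^ e i) = 1) (n : ℕ) :
    PowerSeries.coeff n V = (if n = 0 then 1 else 0) +
      ∑ i ∈ Finset.range N, if e i ≤ n then b i * PowerSeries.coeff (n - e i) V else 0 := by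
  have h1 : V = 1 + ∑ i ∈ Finset.range N,
      PowerSeries.C (b i) * (PowerSeries.X ^ e i * V) := by
    simp only [← mul_assoc, ← Finset.sum_mul]
    linear_combination h
  conv_lhs => rw [h1]
  rw [map_add, map_sum, PowerSeries.coeff_one]
  congr 1
  refine Finset.sum_congr rfl fun i _ => ?_
  rw [PowerSeries.coeff_C_mul, PowerSeries.coeff_X_pow_mul', mul_ite, mul_zero]

variable {F : Type*} [Field F] [Finite F]

theorem coeff_powerSumSeries {ι : F[X] →+* K} (hι : Function.Injective ι) {d N : ℕ} (hN : d < N)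
    (n : ℕ) :
    PowerSeries.coeff n (powerSumSeries ι d) = (if n = 0 then 1 else 0) +
      ∑ i ∈ Finset.range N, if Nat.card F ^ i ≤ n then
        twistEval ι d (andersonThakurG F i) / ι (carlitzD F i) *
          PowerSeries.coeff (n - Nat.card F ^ i) (powerSumSeries ι d) else 0 := by
  rw [coeff_of_mul_one_sub_eq_one (powerSumSeries_mul hι d) n]
  simp only [carlitzECoeff_mul_div hι]
  congr 1
  refine Finset.sum_subset (Finset.range_mono hN) fun i _ hi => ?_
  rw [twistEval_andersonThakurG_of_lt ι (by simpa using hi)]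
  simp

theorem coeff_andersonThakurKernel_mul (V : PowerSeries (FieldThetaT F)) {n N : ℕ} (hN : n < N) :
    PowerSeries.coeff n (andersonThakurKernel F * V) =
      ∑ i ∈ Finset.range N, if Nat.card F ^ i ≤ n then
        algebraMap F[X][X] (FieldThetaT F) (andersonThakurG F i) /
          algebraMap F[X][X] (FieldThetaT F) (substT F (carlitzD F i)) *
            PowerSeries.coeff (n - Nat.card F ^ i) V else 0 := by
  set b : ℕ → FieldThetaT F := fun i => algebraMap F[X][X] (FieldThetaT F) (andersonThakurG F i) /
    algebraMap F[X][X] (FieldThetaT F) (substT F (carlitzD F i)) with hb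
  have h : PowerSeries.coeff n (andersonThakurKernel F * V) = PowerSeries.coeff n
      ((∑ i ∈ Finset.range N, PowerSeries.C (b i) * PowerSeries.X ^ Nat.card F ^ i) * V) := by
    rw [PowerSeries.coeff_mul, PowerSeries.coeff_mul]
    refine Finset.sum_congr rfl fun x hx => ?_
    congr 1
    have hx' := Finset.HasAntidiagonal.mem_antidiagonal.1 hx
    rw [andersonThakurKernel, PowerSeries.coeff_mk, map_sum, Finset.sum_filter]
    simp only [PowerSeries.coeff_C_mul, PowerSeries.coeff_X_pow, mul_ite, mul_one, mul_zero,
      eq_comm (a := x.1)]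
    -- Indices `i` above the exponent contribute nothing, as `i < q ^ i`.
    refine Finset.sum_subset (Finset.range_mono (by omega)) fun i _ hi => if_neg ?_
    have := Nat.lt_pow_self (n := i) (Finite.one_lt_card (α := F))
    have : x.1 + 1 ≤ i := by simpa using hi
    omega
  rw [h, Finset.sum_mul, map_sum]
  refine Finset.sum_congr rfl fun i _ => ?_
  rw [mul_assoc, PowerSeries.coeff_C_mul, PowerSeries.coeff_X_pow_mul', mul_ite, mul_zero]

/-- The recursion read off from the defining series, kept inside `A[t]`: the multipliers `c i` are
the integral quotients of Carlitz factorials. -/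
theorem andersonThakur_recursion {n N : ℕ} (hN : n < N) :
    ∃ c : ℕ → F[X],
      (∀ i, Nat.card F ^ i ≤ n → carlitzFactorial F n =
        c i * (carlitzD F i * carlitzFactorial F (n - Nat.card F ^ i))) ∧
      andersonThakur (F := F) n = (if n = 0 then 1 else 0) +
        ∑ i ∈ Finset.range N, if Nat.card F ^ i ≤ n then
          andersonThakurG F i * substT F (c i) * andersonThakur (n - Nat.card F ^ i) else 0 := by
  have hdvd : ∀ i, ∃ c, Nat.card F ^ i ≤ n → carlitzFactorial F n =
      c * (carlitzD F i * carlitzFactorial F (n - Nat.card F ^ i)) := by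
    intro i
    by_cases h : Nat.card F ^ i ≤ n
    · obtain ⟨c, hc⟩ := carlitzD_mul_carlitzFactorial_dvd (F := F) i (n - Nat.card F ^ i)
      rw [Nat.sub_add_cancel h] at hc
      exact ⟨c, fun _ => by rw [hc, mul_comm]⟩
    · exact ⟨0, fun h2 => absurd h2 h⟩
  choose c hc using hdvd
  refine ⟨c, hc, IsFractionRing.injective F[X][X] (FieldThetaT F) ?_⟩
  have hne : ∀ a : F[X], a ≠ 0 → algebraMap F[X][X] (FieldThetaT F) (substT F a) ≠ 0 := by
    intro a ha
    rw [Ne, IsFractionRing.to_map_eq_zero_iff, map_eq_zero_iff _ substT_injective]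
    exact ha
  have hmul : (1 - andersonThakurKernel F) * (1 - andersonThakurKernel F)⁻¹ = 1 := by
    refine PowerSeries.mul_inv_cancel _ ?_
    rw [map_sub, ← PowerSeries.coeff_zero_eq_constantCoeff_apply (andersonThakurKernel F),
      coeff_zero_andersonThakurKernel]
    simp
  have hV : (1 - andersonThakurKernel F)⁻¹ =
      1 + andersonThakurKernel F * (1 - andersonThakurKernel F)⁻¹ := by
    linear_combination hmul
  have h0 : carlitzFactorial F 0 = 1 := by simp [carlitzFactorial]
  rw [algebraMap_andersonThakur, andersonThakurFrac, hV, map_add,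
    coeff_andersonThakurKernel_mul _ hN, mul_add, map_add, map_sum, Finset.mul_sum,
    PowerSeries.coeff_one]
  congr 1
  · split_ifs with h
    · simp [h, carlitzGamma, h0]
    · simp
  · refine Finset.sum_congr rfl fun i _ => ?_
    split_ifs with h
    · have hD := hne _ (carlitzD_ne_zero (F := F) i)
      rw [map_mul, map_mul, algebraMap_andersonThakur, andersonThakurFrac]
      simp only [carlitzGamma, Nat.add_sub_cancel]
      rw [hc i h]
      simp only [map_mul]
      field_simp
    · simp

/-- For `d > 0` the substitution kills `t ^ (q ^ d) - θ`, so it does not extend to `F(θ, t)` and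
cannot be applied to the defining series. Both sides are instead shown to obey the same recursion.
-/
theorem twistEval_andersonThakur {ι : F[X] →+* K} (hι : Function.Injective ι) (d n : ℕ) :
    twistEval ι d (andersonThakur n) =
      ι (carlitzFactorial F n) * PowerSeries.coeff n (powerSumSeries ι d) := by
  induction n using Nat.strong_induction_on with
  | _ n ih =>
    -- This `N` exceeds both `n` and `d`, as the two recursions require.
    obtain ⟨c, hc, hH⟩ := andersonThakur_recursion (F := F) (n := n) (N := n + d + 1) (by omega)
    have h0 : carlitzFactorial F 0 = 1 := by simp [carlitzFactorial]
    rw [hH, coeff_powerSumSeries hι (N := n + d + 1) (by omega), map_add, map_sum, mul_add,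
      Finset.mul_sum]
    congr 1
    · split_ifs with h
      · simp [h, h0]
      · simp
    · refine Finset.sum_congr rfl fun i _ => ?_
      split_ifs with h
      · have hD : ι (carlitzD F i) ≠ 0 := (map_ne_zero_iff ι hι).2 (carlitzD_ne_zero i)
        have hq : 0 < Nat.card F ^ i := pow_pos Nat.card_pos _
        rw [map_mul, map_mul, twistEval_substT, ih _ (by omega), hc i h, map_mul, map_mul]
        field_simp
      · simp

end Recursion

/-! ### The power sum formula in residue fields, and its products -/

section Reduction

variable {F : Type*} [Field F] [Finite F] {K : Type*} [Field K]

theorem map_sum_prod_erase (ι : F[X] →+* K) (s : ℕ) {d : ℕ} (h : ∀ a ∈ monics F d, ι a ≠ 0)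
    [DecidableEq F[X]] :
    ι (∑ a ∈ monics F d, ∏ b ∈ (monics F d).erase a, b ^ s) =
      (∏ a ∈ monics F d, ι a ^ s) * powerSum ι d s := by
  rw [powerSum, map_sum, Finset.mul_sum]
  refine Finset.sum_congr rfl fun a ha => ?_
  rw [← Finset.mul_prod_erase _ _ ha, map_prod]
  simp only [map_pow]
  have := h a ha
  field_simp

theorem sum_andersonThakurCoeff_of_injective {ι : F[X] →+* K} (hι : Function.Injective ι) (d : ℕ)
    {s : ℕ} (hs : 0 < s) :
    ∑ j ∈ Finset.range ((andersonThakur (F := F) (s - 1)).natDegree + 1),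
        ι (andersonThakurCoeff s j) ^ Nat.card F ^ d * ι X ^ j =
      ι (carlitzGamma F s) * (ι (carlitzL F d) ^ s * powerSum ι d s) := by
  have h := twistEval_andersonThakur hι d (s - 1)
  rw [twistEval_apply, powerSumSeries, PowerSeries.coeff_mk, Nat.sub_add_cancel hs] at h
  exact h

/-- The theorem of Anderson and Thakur on power sums, in any field where the monic polynomials
of degree `d` are invertible. -/
theorem sum_andersonThakurCoeff (ι : F[X] →+* K) {d s : ℕ} (hs : 0 < s)
    (h : ∀ a ∈ monics F d, ι a ≠ 0) :
    ∑ j ∈ Finset.range ((andersonThakur (F := F) (s - 1)).natDegree + 1),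
        ι (andersonThakurCoeff s j) ^ Nat.card F ^ d * ι X ^ j =
      ι (carlitzGamma F s) * (ι (carlitzL F d) ^ s * powerSum ι d s) := by
  classical
  have hinj := IsFractionRing.injective F[X] (FractionRing F[X])
  -- Multiplied by `∏ a ^ s`, the formula lies in `A`; it is proved in the fraction field and then
  -- mapped by `ι`, which need not be injective.
  have key : (∏ a ∈ monics F d, a ^ s) *
      ∑ j ∈ Finset.range ((andersonThakur (F := F) (s - 1)).natDegree + 1),
        andersonThakurCoeff s j ^ Nat.card F ^ d * X ^ j =
      carlitzGamma F s * (carlitzL F d ^ s *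
        ∑ a ∈ monics F d, ∏ b ∈ (monics F d).erase a, b ^ s) := by
    refine hinj ?_
    have h1 := sum_andersonThakurCoeff_of_injective hinj d hs
    have h2 := map_sum_prod_erase (algebraMap F[X] (FractionRing F[X])) s (d := d)
      fun a ha => (map_ne_zero_iff _ hinj).2 (mem_monics.1 ha).1.ne_zero
    rw [map_mul, map_mul, map_mul, h2, map_prod, map_sum]
    simp only [map_mul, map_pow]
    rw [h1]
    ring
  have hne : ∏ a ∈ monics F d, ι a ^ s ≠ 0 :=
    Finset.prod_ne_zero_iff.2 fun a ha => pow_ne_zero _ (h a ha)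
  refine mul_left_cancel₀ hne ?_
  have := congrArg ι key
  rw [map_mul, map_mul, map_mul, map_sum_prod_erase ι s h, map_prod, map_sum] at this
  simp only [map_mul, map_pow] at this
  rw [this]
  ring

theorem pow_card_pow_of_pow_card_sub_one (ι : F[X] →+* K) {ε : F[X]ˣ} {g : K}
    (h : g ^ (Nat.card F - 1) = ι ε) (d : ℕ) : g ^ Nat.card F ^ d = ι ε ^ d * g := by
  have hq : 0 < Nat.card F := Nat.card_pos
  obtain ⟨c, -, hc⟩ := Polynomial.isUnit_iff.1 ε.isUnit
  have h1 : g ^ Nat.card F = ι ε * g := by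
    rw [← h, ← pow_succ, Nat.sub_add_cancel hq]
  have h2 : ι ε ^ Nat.card F = ι ε := by
    have := map_C_pow ι 1 c
    rwa [pow_one, hc] at this
  induction d with
  | zero => simp
  | succ d ih => rw [pow_succ, pow_mul, ih, mul_pow, pow_right_comm, h2, h1, pow_succ, mul_assoc]

-- Tuples are grouped by their degree vectors; over a fixed vector the entries vary independently,
-- so the sum factors.
open scoped Classical in
theorem sum_monicTuples {r N : ℕ} (f : Fin r → F[X] → K) :
    ∑ a ∈ monicTuples F r N, ∏ i, f i (a i) =
      ∑ d ∈ (Fintype.piFinset fun _ : Fin r => Finset.range N).filter fun d => StrictAnti d,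
        ∏ i, ∑ a ∈ monics F (d i), f i a := by
  have hmem : ∀ a : Fin r → F[X], a ∈ monicTuples F r N ↔ (∀ i, (a i).Monic) ∧
      (∀ i, (a i).natDegree < N) ∧ StrictAnti fun i => (a i).natDegree := by
    simp [monicTuples]
  rw [← Finset.sum_fiberwise_of_maps_to (g := fun a i => (a i).natDegree)
    (t := (Fintype.piFinset fun _ : Fin r => Finset.range N).filter fun d => StrictAnti d)]
  · refine Finset.sum_congr rfl fun d hd => ?_
    rw [Finset.prod_univ_sum]
    refine Finset.sum_congr ?_ fun _ _ => rfl
    ext a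
    simp only [Finset.mem_filter, Fintype.mem_piFinset, hmem, mem_monics, Finset.mem_range] at hd ⊢
    constructor
    · rintro ⟨⟨h1, -, -⟩, rfl⟩ i
      exact ⟨h1 i, rfl⟩
    · intro h
      obtain rfl : (fun i => (a i).natDegree) = d := funext fun i => (h i).2
      exact ⟨⟨fun i => (h i).1, hd⟩, rfl⟩
  · intro a ha
    simpa using ((hmem a).1 ha).2

-- For a fixed degree vector `d`, the sum over `j` factors over the slots, and slot `i` is one
-- instance of `sum_andersonThakurCoeff`. The `Γ` factors stay in the numerator because they may
-- vanish modulo `Q`.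
open scoped Classical in
theorem sum_indexSet_polylog (ι : F[X] →+* K) {r N : ℕ}
    (hmonic : ∀ d < N, ∀ a ∈ monics F d, ι a ≠ 0) (hL : ∀ d < N, ι (carlitzL F d) ≠ 0)
    (s : Fin r → ℕ) (hs : ∀ i, 0 < s i) (ε : Fin r → F[X]ˣ) (g : Fin r → K)
    (hg : ∀ i, g i ^ (Nat.card F - 1) = ι (ε i)) :
    ∑ j ∈ indexSet F s, ι X ^ (∑ i, j i) *
        ∑ d ∈ (Fintype.piFinset fun _ : Fin r => Finset.range N).filter fun d => StrictAnti d,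
          (∏ i, (g i * ι (andersonThakurCoeff (s i) (j i))) ^ Nat.card F ^ d i) /
            ∏ i, ι (carlitzL F (d i)) ^ s i =
      (∏ i, g i * ι (carlitzGamma F (s i))) * ∑ a ∈ monicTuples F r N,
        (∏ i, ι (ε i) ^ (a i).natDegree) / ∏ i, ι (a i) ^ s i := by
  simp only [← Finset.prod_div_distrib]
  rw [sum_monicTuples (fun i a => ι (ε i) ^ a.natDegree / ι a ^ s i)]
  simp only [Finset.mul_sum]
  rw [Finset.sum_comm]
  refine Finset.sum_congr rfl fun d hd => ?_
  simp only [← Finset.prod_pow_eq_pow_sum, ← Finset.prod_mul_distrib]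
  rw [indexSet, ← Finset.prod_univ_sum
    (fun i => Finset.range ((andersonThakur (F := F) (s i - 1)).natDegree + 1))
    (fun i j => ι X ^ j * ((g i * ι (andersonThakurCoeff (s i) j)) ^ Nat.card F ^ d i /
      ι (carlitzL F (d i)) ^ s i))]
  refine Finset.prod_congr rfl fun i _ => ?_
  have hdi : d i < N := by
    simp only [Finset.mem_filter, Fintype.mem_piFinset, Finset.mem_range] at hd
    exact hd.1 i
  have hLi := pow_ne_zero (s i) (hL _ hdi)
  have h1 : ∑ a ∈ monics F (d i), ι (ε i) ^ a.natDegree / ι a ^ s i =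
      ι (ε i) ^ d i * powerSum ι (d i) (s i) := by
    rw [powerSum, Finset.mul_sum]
    exact Finset.sum_congr rfl fun a ha => by rw [(mem_monics.1 ha).2, div_eq_mul_inv]
  have h2 := sum_andersonThakurCoeff ι (hs i) (hmonic _ hdi)
  calc _ = ι (ε i) ^ d i * g i / ι (carlitzL F (d i)) ^ s i *
        ∑ j ∈ Finset.range ((andersonThakur (F := F) (s i - 1)).natDegree + 1),
          ι (andersonThakurCoeff (s i) j) ^ Nat.card F ^ d i * ι X ^ j := by
        rw [Finset.mul_sum]
        refine Finset.sum_congr rfl fun j _ => ?_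
        rw [mul_pow, pow_card_pow_of_pow_card_sub_one ι (hg i)]
        ring
    _ = _ := by
        rw [h1, h2]
        field_simp

end Reduction

/-! ### Reduction of `A` modulo a prime `Q` of `A'` -/

section Residue

variable {F : Type*} [Field F] {F' : Type*} [Field F'] [Algebra F F']

/-- The homomorphism `A → A' / (Q)`. -/
def toResidue (F : Type*) [Field F] [Algebra F F'] (Q : Spm F') : F[X] →+* Residue Q :=
  (AdjoinRoot.mk Q.1).comp (mapRingHom (algebraMap F F'))

theorem toResidue_apply (Q : Spm F') (a : F[X]) :
    toResidue F Q a = AdjoinRoot.mk Q.1 (a.map (algebraMap F F')) := rfl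

variable [Finite F] [Finite F']

theorem residueMap_mk (Q : Spm F') (a : F[X]) :
    residueMap F Q (AdjoinRoot.mk (below F Q).1 a) = toResidue F Q a := by
  have : (residueMap F Q).comp (AdjoinRoot.mk (below F Q).1) = toResidue F Q := by
    ext c
    · simp [residueMap, toResidue]
    · simp [residueMap, toResidue]
  exact RingHom.congr_fun this a

theorem toResidue_eq_zero_iff (Q : Spm F') (a : F[X]) :
    toResidue F Q a = 0 ↔ (below F Q).1 ∣ a := by
  rw [toResidue_apply, AdjoinRoot.mk_eq_zero, below_dvd_iff]

theorem toResidue_ne_zero_of_mem_monics (Q : Spm F') {d : ℕ} (hd : d < (below F Q).1.natDegree)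
    {a : F[X]} (ha : a ∈ monics F d) : toResidue F Q a ≠ 0 := by
  rw [Ne, toResidue_eq_zero_iff]
  intro h
  have := natDegree_le_of_dvd h (mem_monics.1 ha).1.ne_zero
  rw [(mem_monics.1 ha).2] at this
  omega

/-- If `P` divides `[i]`, then `deg P` divides `i`; here `1 ≤ i ≤ d < deg P`. -/
theorem toResidue_carlitzL_ne_zero (Q : Spm F') {d : ℕ} (hd : d < (below F Q).1.natDegree) :
    toResidue F Q (carlitzL F d) ≠ 0 := by
  rw [carlitzL, map_mul, map_prod]
  refine mul_ne_zero (by simp) (Finset.prod_ne_zero_iff.2 fun i hi => ?_)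
  rw [Ne, toResidue_eq_zero_iff]
  intro h
  have hi' := Finset.mem_Icc.1 hi
  have := Nat.le_of_dvd (by omega) ((below F Q).2.2.natDegree_dvd_of_dvd_X_pow_card_pow_sub_X h)
  omega

end Residue

end FiniteCarlitz

end

/-! ### Assembly in `𝒜_{k'}` -/

theorem mainTheorem2 (F : Type*) [Field F] [Finite F] (F' : Type*) [Field F'] [Finite F']
    [Algebra F F'] (hF' : Nat.card F' = Nat.card F ^ (Nat.card F - 1))
    (r : ℕ) (s : Fin r → ℕ) (hs : ∀ i, 0 < s i)
    (ε : Fin r → (Polynomial F)ˣ) (γ : Fin r → (Polynomial F')ˣ)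
    (hγ : ∀ i, (γ i : Polynomial F') ^ (Nat.card F - 1) =
      Polynomial.map (algebraMap F F') (ε i : Polynomial F)) :
    FiniteCarlitz.embed F (F' := F')
        (FiniteCarlitz.alternatingFMZV (fun i => (s i : ℤ)) ε) =
      (∏ i, algebraMap (Polynomial F') (RatFunc F') (γ i : Polynomial F') *
          FiniteCarlitz.toFunctionField F F' (FiniteCarlitz.carlitzGamma F (s i)))⁻¹ •
        ∑ j ∈ FiniteCarlitz.indexSet F s,
          (RatFunc.X : RatFunc F') ^ (∑ i, j i) •
            FiniteCarlitz.finitePolylog F s (fun i =>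
              algebraMap (RatFunc F') (FiniteCarlitz.𝒜 F')
                (algebraMap (Polynomial F') (RatFunc F') (γ i : Polynomial F') *
                  FiniteCarlitz.toFunctionField F F'
                    (FiniteCarlitz.andersonThakurCoeff (s i) (j i)))) := by
  open FiniteCarlitz in
  have hprod : (∏ i, algebraMap F'[X] (RatFunc F') (γ i : F'[X]) *
      toFunctionField F F' (carlitzGamma F (s i))) =
      algebraMap F'[X] (RatFunc F')
        (∏ i, (γ i : F'[X]) * (carlitzGamma F (s i)).map (algebraMap F F')) := by
    rw [map_prod]
    exact Finset.prod_congr rfl fun i _ => (map_mul _ _ _).symm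
  have hne : (∏ i, algebraMap F'[X] (RatFunc F') (γ i : F'[X]) *
      toFunctionField F F' (carlitzGamma F (s i))) ≠ 0 := by
    rw [hprod, (map_ne_zero_iff _ (IsFractionRing.injective F'[X] (RatFunc F')))]
    exact Finset.prod_ne_zero_iff.2 fun i _ => mul_ne_zero (γ i).ne_zero
      ((Polynomial.map_ne_zero_iff (algebraMap F F').injective).2 (carlitzFactorial_ne_zero _))
  -- The scalar is moved to the other side, so no division by `Γ` takes place in the residue fields.
  rw [eq_inv_smul_iff₀ hne, hprod, Algebra.smul_def, 𝒜.algebraMap_algebraMap]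
  have hterm : ∀ j : Fin r → ℕ, (RatFunc.X : RatFunc F') ^ (∑ i, j i) •
      finitePolylog F s (fun i => algebraMap (RatFunc F') (𝒜 F')
        (algebraMap F'[X] (RatFunc F') (γ i : F'[X]) *
          toFunctionField F F' (andersonThakurCoeff (s i) (j i)))) =
      𝒜.mk (fun Q => AdjoinRoot.mk Q.1 (X ^ (∑ i, j i)) * polylogFamily F s
        (fun i Q => AdjoinRoot.mk Q.1 ((γ i : F'[X]) *
          (andersonThakurCoeff (s i) (j i)).map (algebraMap F F'))) Q) := by
    intro j
    have h1 : ∀ i, algebraMap (RatFunc F') (𝒜 F')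
        (algebraMap F'[X] (RatFunc F') (γ i : F'[X]) *
          toFunctionField F F' (andersonThakurCoeff (s i) (j i))) =
        𝒜.mk fun Q => AdjoinRoot.mk Q.1 ((γ i : F'[X]) *
          (andersonThakurCoeff (s i) (j i)).map (algebraMap F F')) := by
      intro i
      rw [← 𝒜.algebraMap_algebraMap, map_mul (algebraMap F'[X] (RatFunc F'))]
      rfl
    simp only [h1]
    rw [finitePolylog_mk, Algebra.smul_def, ← RatFunc.algebraMap_X, ← map_pow,
      𝒜.algebraMap_algebraMap, ← map_mul]
    rfl
  simp only [hterm]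
  rw [alternatingFMZV, embed_mk, ← map_mul, ← map_sum]
  -- With these representatives the two families agree at every `Q`, not only at almost all.
  congr 1
  funext Q
  have hγQ : ∀ i, AdjoinRoot.mk Q.1 (γ i : F'[X]) ^ (Nat.card F - 1) =
      toResidue F Q (ε i) := by
    intro i
    rw [← map_pow, hγ, toResidue_apply]
  have key := sum_indexSet_polylog (toResidue F Q)
    (fun _ hd _ ha => toResidue_ne_zero_of_mem_monics Q hd ha)
    (fun _ hd => toResidue_carlitzL_ne_zero Q hd) s hs ε _ hγQ
  rw [Pi.mul_apply, Finset.sum_apply]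
  simp only [polylogFamily, zpow_natCast, map_sum, map_div₀, map_prod, map_pow, map_mul,
    residueMap_mk]
  simp only [toResidue_apply, Polynomial.map_X] at key ⊢
  rw [← key]
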